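/- Let $d\ge 1$ be an integer and let $\lambda$ denote Lebesgue measure on $\mathbb{R}^d$. For $\eta\in\mathbb{R}$ and $\alpha\in\mathbb{R}^d$, let \[\mathrm{NA}_\eta(\alpha)=\{|q|^{\eta}(q\alpha-p) : q\in\mathbb{Z}\setminus\{0\},\ p\in\mathbb{Z}^d\}\] be the set of $\eta$-normalized approximations to $\alpha$, let $\mathcal{A}_\eta(\alpha)\subseteq\mathbb{R}^d$ be the set of all accumulation points of $\mathrm{NA}_\eta(\alpha)$ (the points $\gamma\in\mathbb{R}^d$ every neighbourhood of which contains an element of $\mathrm{NA}_\eta(\alpha)$ different from $\gamma$), and let \[\mathcal{D}(\eta)=\{\alpha\in\mathbb{R}^d : \mathcal{A}_\eta(\alpha)=\mathbb{R}^d\}.\] Then, for every real number $\eta\le 1/d$, \[\lambda(\mathcal{D}(\eta))=\infty\quad\text{and}\quad \lambda(\mathcal{D}(\eta)^c)=0,\] where $\mathcal{D}(\eta)^c=\mathbb{R}^d\setminus\mathcal{D}(\eta)$. -/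

import Mathlib

open Filter MeasureTheory
open scoped Topology

/-- The `η`-normalized approximations to `α ∈ ℝ^d`: the set of all points `|q|^η (q α - p)` with
`q` a nonzero integer and `p ∈ ℤ^d`. The space `Fin d → ℝ` carries the maximum norm and
(as `volume`) the `d`-dimensional Lebesgue measure. -/
def NormalizedApprox {d : ℕ} (η : ℝ) (α : Fin d → ℝ) : Set (Fin d → ℝ) :=
  {x | ∃ (q : ℤ) (p : Fin d → ℤ), q ≠ 0 ∧
    x = |(q : ℝ)| ^ η • ((q : ℝ) • α - fun i => (p i : ℝ))}

/-- The set of all accumulation points of the `η`-normalized approximations to `α`: every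
neighbourhood of such a point `γ` contains a normalized approximation different from `γ`. -/
def AccumulationSet {d : ℕ} (η : ℝ) (α : Fin d → ℝ) : Set (Fin d → ℝ) :=
  {γ | AccPt γ (𝓟 (NormalizedApprox η α))}

/-- The set of all `α ∈ ℝ^d` for which every point of `ℝ^d` is an accumulation point of the
`η`-normalized approximations to `α`. -/
def DenseApproxSet (d : ℕ) (η : ℝ) : Set (Fin d → ℝ) :=
  {α | AccumulationSet η α = Set.univ}

/-! For `0 ≤ η`, Dirichlet puts infinitely many normalized approximations in the unit ball, hence
within `‖γ‖ + 2` of any target `γ`. Equivalently, `α` lies in infinitely many neighbourhoods of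
shifted rationals, of radius a constant times `q ^ (-η - 1)`. By `blimsup_thickening_mul_ae_eq`,
rescaling these radii changes the limsup set only by a null set, so the constant can be any `ε > 0`.
For `η < 0` rounding suffices. Countably many `γ` and `ε` give density for almost every `α`, and in
a space without isolated points density makes every point an accumulation point. -/

/-- Simultaneous Dirichlet approximation, by the pigeonhole principle on a grid of `N ^ d` cubes. -/
theorem exists_norm_smul_sub_int_lt {d : ℕ} (α : Fin d → ℝ) {N : ℕ} (hN : 0 < N) :
    ∃ (q : ℕ) (p : Fin d → ℤ), 0 < q ∧ q ≤ N ^ d ∧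
      ‖(q : ℝ) • α - fun i => (p i : ℝ)‖ < (N : ℝ)⁻¹ := by
  have hN' : (0 : ℝ) < N := by exact_mod_cast hN
  let f : ℕ → Fin d → ℕ := fun k i => ⌊Int.fract ((k : ℝ) * α i) * N⌋₊
  have hmaps : ∀ k ∈ Finset.range (N ^ d + 1),
      f k ∈ Fintype.piFinset fun _ : Fin d => Finset.range N := by
    intro k _
    simp only [Fintype.mem_piFinset, Finset.mem_range]
    intro i
    rw [Nat.floor_lt (by positivity)]
    nlinarith [Int.fract_lt_one ((k : ℝ) * α i)]
  have hcard : (Fintype.piFinset fun _ : Fin d => Finset.range N).card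
      < (Finset.range (N ^ d + 1)).card := by
    simp
  obtain ⟨a, ha, b, hb, hab, hf⟩ := Finset.exists_ne_map_eq_of_card_lt_of_maps_to hcard hmaps
  wlog hlt : a < b generalizing a b
  · exact this b hb a ha hab.symm hf.symm (by omega)
  simp only [Finset.mem_range] at ha hb
  refine ⟨b - a, fun i => ⌊(b : ℝ) * α i⌋ - ⌊(a : ℝ) * α i⌋, by omega, by omega, ?_⟩
  rw [pi_norm_lt_iff (by positivity)]
  intro i
  have hi : f a i = f b i := congrFun hf i
  simp only [f] at hi
  have h1 := Nat.floor_le (show (0 : ℝ) ≤ Int.fract ((a : ℝ) * α i) * N by positivity)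
  have h2 := Nat.lt_floor_add_one (Int.fract ((a : ℝ) * α i) * N)
  have h3 := Nat.floor_le (show (0 : ℝ) ≤ Int.fract ((b : ℝ) * α i) * N by positivity)
  have h4 := Nat.lt_floor_add_one (Int.fract ((b : ℝ) * α i) * N)
  rw [← hi] at h3 h4
  have key : |(Int.fract ((b : ℝ) * α i) - Int.fract ((a : ℝ) * α i)) * N| < 1 := by
    rw [abs_lt]
    constructor <;> linarith
  rw [abs_mul, abs_of_pos hN', ← lt_div_iff₀ hN', one_div] at key
  refine lt_of_eq_of_lt ?_ key
  rw [Real.norm_eq_abs]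
  congr 1
  simp only [Int.fract, Pi.sub_apply, Pi.smul_apply, smul_eq_mul]
  push_cast [Nat.cast_sub hlt.le]
  ring

/-- Dirichlet's theorem provides infinitely many simultaneous approximations with exponent `1 / d`
(hence with every smaller exponent). -/
theorem frequently_exists_norm_rpow_smul_le_one {d : ℕ} (hd : 1 ≤ d) {η : ℝ} (hη : η ≤ 1 / (d : ℝ))
    (α : Fin d → ℝ) :
    ∃ᶠ q : ℕ in atTop, ∃ p : Fin d → ℤ,
      ‖(q : ℝ) ^ η • ((q : ℝ) • α - fun i => (p i : ℝ))‖ ≤ 1 := by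
  intro hev
  obtain ⟨Q, hQ⟩ := eventually_atTop.1 hev
  have hd' : (0 : ℝ) < d := by exact_mod_cast hd
  have hpos : ∀ (q : ℕ) (p : Fin d → ℤ), 0 < q →
      0 < ‖(q : ℝ) • α - fun i => (p i : ℝ)‖ := by
    intro q p hq
    rw [norm_pos_iff]
    intro h0
    -- A zero error persists for multiples of `q`, and `Q * q` lies in the range excluded by `hQ`.
    refine hQ (Q * q) (Nat.le_mul_of_pos_right Q hq) ⟨fun i => Q * p i, ?_⟩
    have : ((Q * q : ℕ) : ℝ) • α - (fun i => ((Q * p i : ℤ) : ℝ))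
        = (Q : ℝ) • ((q : ℝ) • α - fun i => (p i : ℝ)) := by
      ext i
      simp
      ring
    rw [this, h0]
    simp
  have hsmall : ∀ q : ℕ, 0 < q → ∃ N₀ : ℕ, ∀ N ≥ N₀, ∀ p : Fin d → ℤ,
      (N : ℝ)⁻¹ ≤ ‖(q : ℝ) • α - fun i => (p i : ℝ)‖ := by
    intro q hq
    let p₀ : Fin d → ℤ := fun i => round ((q : ℝ) * α i)
    obtain ⟨N₀, hN₀⟩ := exists_nat_gt ‖(q : ℝ) • α - fun i => (p₀ i : ℝ)‖⁻¹
    refine ⟨N₀, fun N hN p => ?_⟩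
    have h1 : ‖(q : ℝ) • α - fun i => (p₀ i : ℝ)‖ ≤ ‖(q : ℝ) • α - fun i => (p i : ℝ)‖ := by
      rw [pi_norm_le_iff_of_nonneg (norm_nonneg _)]
      intro i
      refine le_trans ?_ (norm_le_pi_norm _ i)
      simpa [p₀] using round_le ((q : ℝ) * α i) (p i)
    refine le_trans ?_ h1
    have hN' : (N₀ : ℝ) ≤ N := by exact_mod_cast hN
    exact inv_le_of_inv_le₀ (hpos q p₀ hq) (hN₀.le.trans hN')
  choose! N₀ hN₀ using hsmall
  -- For this `N`, `N⁻¹` is at most the least error of each positive `q < Q`, so Dirichlet's `q` is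
  -- at least `Q`.
  let N := (Finset.range Q).sup N₀ + 1
  obtain ⟨q, p, hq, hqN, hlt⟩ := exists_norm_smul_sub_int_lt α (N := N) (Nat.succ_pos _)
  have hQq : Q ≤ q := by
    by_contra! h
    have hle : N₀ q ≤ N := (Finset.le_sup (Finset.mem_range.2 h)).trans (Nat.le_succ _)
    exact absurd hlt (hN₀ q hq N hle p).not_gt
  refine hQ q hQq ⟨p, ?_⟩
  have hq1 : (1 : ℝ) ≤ q := by exact_mod_cast hq
  have hN0 : (0 : ℝ) < N := by positivity
  have hpow : (q : ℝ) ^ η ≤ N := by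
    calc (q : ℝ) ^ η ≤ (q : ℝ) ^ (1 / (d : ℝ)) := Real.rpow_le_rpow_of_exponent_le hq1 hη
      _ ≤ ((N : ℝ) ^ d) ^ (1 / (d : ℝ)) := by
        refine Real.rpow_le_rpow (by positivity) ?_ (by positivity)
        exact_mod_cast hqN
      _ = N := by
        rw [one_div, Real.pow_rpow_inv_natCast hN0.le (by omega)]
  rw [norm_smul, Real.norm_of_nonneg (by positivity)]
  calc _ ≤ (N : ℝ) * (N : ℝ)⁻¹ := by gcongr
    _ = 1 := mul_inv_cancel₀ hN0.ne'

/-- The shifted rational points `(p + q ^ (-η) γ) / q`, with `p` ranging over `ℤ ^ d`. -/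
def shiftedRationals {d : ℕ} (η : ℝ) (γ : Fin d → ℝ) (q : ℕ) : Set (Fin d → ℝ) :=
  {x | ∃ p : Fin d → ℤ, x = (q : ℝ)⁻¹ • ((fun i => (p i : ℝ)) + (q : ℝ) ^ (-η) • γ)}

/-- Dividing by `q ^ (η + 1)` moves the condition from the approximation to `α` itself, the form
needed for the scaling lemma. -/
theorem mem_thickening_shiftedRationals {d : ℕ} {η : ℝ} {γ α : Fin d → ℝ} {q : ℕ} (hq : 0 < q)
    (C : ℝ) :
    α ∈ Metric.thickening (C * ((q : ℝ) ^ (-η) * (q : ℝ)⁻¹)) (shiftedRationals η γ q) ↔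
      ∃ p : Fin d → ℤ, ‖(q : ℝ) ^ η • ((q : ℝ) • α - fun i => (p i : ℝ)) - γ‖ < C := by
  have hq' : (0 : ℝ) < q := by exact_mod_cast hq
  have hpow : (0 : ℝ) < (q : ℝ) ^ η := Real.rpow_pos_of_pos hq' η
  have key : ∀ p : Fin d → ℤ, (q : ℝ) ^ η • ((q : ℝ) • α - fun i => (p i : ℝ)) - γ =
      ((q : ℝ) ^ η * q) • (α - (q : ℝ)⁻¹ • ((fun i => (p i : ℝ)) + (q : ℝ) ^ (-η) • γ)) := by
    intro p
    ext i
    simp only [Pi.sub_apply, Pi.smul_apply, Pi.add_apply, smul_eq_mul, Real.rpow_neg hq'.le]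
    field_simp
    ring
  have hiff : ∀ p : Fin d → ℤ,
      dist α ((q : ℝ)⁻¹ • ((fun i => (p i : ℝ)) + (q : ℝ) ^ (-η) • γ)) <
        C * ((q : ℝ) ^ (-η) * (q : ℝ)⁻¹) ↔
      ‖(q : ℝ) ^ η • ((q : ℝ) • α - fun i => (p i : ℝ)) - γ‖ < C := by
    intro p
    rw [key, norm_smul, Real.norm_of_nonneg (by positivity), ← dist_eq_norm, Real.rpow_neg hq'.le,
      ← mul_inv, ← div_eq_mul_inv, lt_div_iff₀ (by positivity), mul_comm]
  simp only [Metric.mem_thickening_iff, shiftedRationals, Set.mem_ofPred_eq]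
  constructor
  · rintro ⟨_, ⟨p, rfl⟩, h⟩
    exact ⟨p, (hiff p).1 h⟩
  · rintro ⟨p, h⟩
    exact ⟨_, ⟨p, rfl⟩, (hiff p).2 h⟩

/-- Dirichlet's theorem shows that every point is a frequent approximation of quality
`‖γ‖ + 2`; by Cassels' scaling lemma the constant may be replaced by any `ε > 0` almost
everywhere. -/
theorem ae_frequently_exists_norm_sub_lt {d : ℕ} (hd : 1 ≤ d) {η : ℝ} (hη₀ : 0 ≤ η)
    (hη : η ≤ 1 / (d : ℝ)) (γ : Fin d → ℝ) {ε : ℝ} (hε : 0 < ε) :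
    ∀ᵐ α : Fin d → ℝ, ∃ᶠ q : ℕ in atTop, ∃ p : Fin d → ℤ,
      ‖(q : ℝ) ^ η • ((q : ℝ) • α - fun i => (p i : ℝ)) - γ‖ < ε := by
  let r : ℕ → ℝ := fun q => ε * ((q : ℝ) ^ (-η) * (q : ℝ)⁻¹)
  have hr : Tendsto r atTop (𝓝 0) := by
    have h : Tendsto (fun q : ℕ => ε * (q : ℝ)⁻¹) atTop (𝓝 0) := by
      simpa using tendsto_inv_atTop_nhds_zero_nat (𝕜 := ℝ) |>.const_mul ε
    refine squeeze_zero' (Eventually.of_forall fun q => by positivity) ?_ h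
    filter_upwards [eventually_ge_atTop 1] with q hq
    have hq1 : (1 : ℝ) ≤ q := by exact_mod_cast hq
    have h1 : (q : ℝ) ^ (-η) ≤ 1 := Real.rpow_le_one_of_one_le_of_nonpos hq1 (by linarith)
    have h2 : (0 : ℝ) ≤ (q : ℝ)⁻¹ := by positivity
    simp only [r]
    gcongr
    nlinarith
  have hscale := blimsup_thickening_mul_ae_eq (volume : Measure (Fin d → ℝ)) (fun _ => True)
    (shiftedRationals η γ) (M := (‖γ‖ + 2) / ε) (by positivity) r hr
  filter_upwards [hscale.mem_iff] with α hα
  simp only [blimsup_true, mem_limsup_iff_frequently_mem] at hα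
  -- Dirichlet gives distance at most `1 + ‖γ‖`; the `2` in `M` makes the bound strict, as an open
  -- thickening requires.
  have hfreq := hα.1 <| by
    refine ((frequently_exists_norm_rpow_smul_le_one hd hη α).and_eventually
      (eventually_gt_atTop 0)).mono ?_
    rintro q ⟨⟨p, hp⟩, hq⟩
    have hM : (‖γ‖ + 2) / ε * r q = (‖γ‖ + 2) * ((q : ℝ) ^ (-η) * (q : ℝ)⁻¹) := by
      simp only [r]
      field_simp
    rw [hM, mem_thickening_shiftedRationals hq]
    refine ⟨p, (norm_sub_le _ _).trans_lt ?_⟩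
    linarith
  refine (hfreq.and_eventually (eventually_gt_atTop 0)).mono ?_
  rintro q ⟨h, hq⟩
  exact (mem_thickening_shiftedRationals hq ε).1 h

/-- For a negative exponent, rounding already gives arbitrarily good normalized approximations. -/
theorem eventually_exists_norm_sub_lt_of_neg {d : ℕ} {η : ℝ} (hη : η < 0) (α γ : Fin d → ℝ)
    {ε : ℝ} (hε : 0 < ε) :
    ∀ᶠ q : ℕ in atTop, ∃ p : Fin d → ℤ,
      ‖(q : ℝ) ^ η • ((q : ℝ) • α - fun i => (p i : ℝ)) - γ‖ < ε := by
  have hlim : Tendsto (fun q : ℕ => (q : ℝ) ^ η) atTop (𝓝 0) := by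
    have := (tendsto_rpow_neg_atTop (neg_pos.2 hη)).comp (tendsto_natCast_atTop_atTop (R := ℝ))
    simpa [Function.comp_def] using this
  filter_upwards [hlim.eventually_lt_const hε, eventually_gt_atTop 0] with q hlt hq
  have hq' : (0 : ℝ) < q := by exact_mod_cast hq
  have hpow : (0 : ℝ) < (q : ℝ) ^ η := Real.rpow_pos_of_pos hq' η
  -- Rounding `y` costs at most `q ^ η / 2` per coordinate.
  let y : Fin d → ℝ := fun i => q * α i - ((q : ℝ) ^ η)⁻¹ * γ i
  refine ⟨fun i => round (y i), ?_⟩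
  rw [pi_norm_lt_iff hε]
  intro i
  have h : ((q : ℝ) ^ η • ((q : ℝ) • α - fun i => (round (y i) : ℝ)) - γ) i =
      (q : ℝ) ^ η * (y i - round (y i)) := by
    simp only [Pi.sub_apply, Pi.smul_apply, smul_eq_mul, y]
    field_simp
    ring
  rw [h, norm_mul, Real.norm_of_nonneg hpow.le, Real.norm_eq_abs]
  nlinarith [abs_sub_round (y i)]

theorem ae_exists_mem_normalizedApprox_dist_lt {d : ℕ} (hd : 1 ≤ d) {η : ℝ}
    (hη : η ≤ 1 / (d : ℝ)) (γ : Fin d → ℝ) {ε : ℝ} (hε : 0 < ε) :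
    ∀ᵐ α : Fin d → ℝ, ∃ x ∈ NormalizedApprox η α, dist x γ < ε := by
  have h : ∀ᵐ α : Fin d → ℝ, ∃ᶠ q : ℕ in atTop, ∃ p : Fin d → ℤ,
      ‖(q : ℝ) ^ η • ((q : ℝ) • α - fun i => (p i : ℝ)) - γ‖ < ε := by
    rcases lt_or_ge η 0 with hneg | hnonneg
    · exact ae_of_all _ fun α => (eventually_exists_norm_sub_lt_of_neg hneg α γ hε).frequently
    · exact ae_frequently_exists_norm_sub_lt hd hnonneg hη γ hε
  filter_upwards [h] with α hα
  obtain ⟨q, ⟨p, hp⟩, hq⟩ := (hα.and_eventually (eventually_gt_atTop 0)).exists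
  refine ⟨_, ⟨(q : ℤ), p, by exact_mod_cast hq.ne', rfl⟩, ?_⟩
  rw [dist_eq_norm]
  simpa using hp

theorem ae_dense_normalizedApprox {d : ℕ} (hd : 1 ≤ d) {η : ℝ} (hη : η ≤ 1 / (d : ℝ)) :
    ∀ᵐ α : Fin d → ℝ, Dense (NormalizedApprox η α) := by
  have h : ∀ᵐ α : Fin d → ℝ, ∀ m n : ℕ, ∃ x ∈ NormalizedApprox η α,
      dist x (TopologicalSpace.denseSeq (Fin d → ℝ) m) < 1 / ((n : ℝ) + 1) := by
    simp only [ae_all_iff]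
    exact fun m n => ae_exists_mem_normalizedApprox_dist_lt hd hη _ Nat.one_div_pos_of_nat
  filter_upwards [h] with α hα
  rw [← dense_closure]
  refine (TopologicalSpace.denseRange_denseSeq (Fin d → ℝ)).mono ?_
  rintro _ ⟨m, rfl⟩
  rw [Metric.mem_closure_iff]
  intro ε hε
  obtain ⟨n, hn⟩ := exists_nat_one_div_lt hε
  obtain ⟨x, hx, hdist⟩ := hα m n
  exact ⟨x, hx, by rw [dist_comm]; exact hdist.trans hn⟩

theorem Dense.accPt_principal {X : Type*} [TopologicalSpace X] [T1Space X] {s : Set X}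
    (hs : Dense s) (x : X) [(𝓝[≠] x).NeBot] : AccPt x (𝓟 s) := by
  rw [accPt_principal_iff_clusterPt, ← mem_closure_iff_clusterPt]
  exact hs.sdiff_singleton x x

theorem theorem1 (d : ℕ) (hd : 1 ≤ d) (η : ℝ) (hη : η ≤ 1 / (d : ℝ)) :
    volume (DenseApproxSet d η) = ⊤ ∧ volume (DenseApproxSet d η)ᶜ = 0 := by
  -- Positive dimension rules out isolated points and makes the total volume infinite.
  have : Nonempty (Fin d) := ⟨⟨0, hd⟩⟩
  have hcompl : volume (DenseApproxSet d η)ᶜ = 0 := by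
    refine mem_ae_iff.1 ?_
    filter_upwards [ae_dense_normalizedApprox hd hη] with α hα
    exact Set.eq_univ_of_forall fun γ => hα.accPt_principal γ
  refine ⟨?_, hcompl⟩
  rw [measure_of_measure_compl_eq_zero hcompl]
  exact measure_univ_of_isAddLeftInvariant _
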